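/- The number of friezes of Dynkin type $E_6$ is exactly $868$. Here a frieze (also called a mesh frieze) of type $E_6$ is a collection of positive integers $\mathcal F(M)$, one for each vertex $M$ (isomorphism class of indecomposable objects) of the Auslander–Reiten quiver of the cluster category of type $E_6$, such that for every Auslander–Reiten triangle $A \to \bigoplus_{i=1}^{I} B_i \to C \to A[1]$ with indecomposable $B_i$ one has $$\mathcal F(A)\,\mathcal F(C) = \prod_{i=1}^{I} \mathcal F(B_i) + 1 .$$ The Auslander–Reiten quiver of the cluster category of type $E_6$ is the quotient of the repetition quiver $\mathbb Z E_6$ by the automorphism $\tau^{-1}[1]$; it has $42$ vertices. -/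

import Mathlib

namespace FriezeE6

/-- An orientation of the Dynkin diagram `E₆` (Bourbaki labelling shifted by one, so the diagram is
the path `0 - 2 - 3 - 4 - 5` together with the edge `1 - 3`): two vertices are joined when the
corresponding entry of the Cartan matrix is `-1`, and `0`, `3`, `5` are the sources. It is
invariant under the diagram automorphism. -/
def Arrow (i j : Fin 6) : Prop :=
  CartanMatrix.E₆ i j = -1 ∧ (i = 0 ∨ i = 3 ∨ i = 5)

instance (i j : Fin 6) : Decidable (Arrow i j) := by
  unfold Arrow; infer_instance

/-- The nontrivial automorphism of the Dynkin diagram `E₆`. -/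
def diagramAut : Equiv.Perm (Fin 6) := Equiv.swap 0 5 * Equiv.swap 2 4

/-- Vertices of the repetition quiver `ℤE₆`, that is, of the Auslander-Reiten quiver of the bounded
derived category of type `E₆`. -/
abbrev Vertex : Type := Fin 6 × ℤ

/-- The direct predecessors of a vertex of `ℤE₆`. Each arrow `j ⟶ i` of the oriented diagram gives
the arrows `(j, m) ⟶ (i, m)` and `(i, m - 1) ⟶ (j, m)` of `ℤE₆`, for all integers `m`. There are no
multiple arrows. -/
def preds (x : Vertex) : Finset Vertex :=
  ((Finset.univ.filter fun j => Arrow j x.1).image fun j => (j, x.2)) ∪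
    ((Finset.univ.filter fun j => Arrow x.1 j).image fun j => (j, x.2 - 1))

/-- The Auslander-Reiten translation `τ` of `ℤE₆`. -/
def tau : Equiv.Perm Vertex where
  toFun x := (x.1, x.2 - 1)
  invFun x := (x.1, x.2 + 1)
  left_inv x := by simp
  right_inv x := by simp

/-- The automorphism of `ℤE₆` induced by the shift functor `[1]` of the derived category: the
sixth power (half of the Coxeter number) of `τ⁻¹`, composed with the diagram automorphism. -/
def shift : Equiv.Perm Vertex where
  toFun x := (diagramAut x.1, x.2 + 6)
  invFun x := (diagramAut.symm x.1, x.2 - 6)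
  left_inv x := by simp
  right_inv x := by simp

/-- The automorphism `τ⁻¹[1]`; the cluster category is the orbit category of the derived category
under it. -/
def orbitAut : Equiv.Perm Vertex := tau⁻¹ * shift

/-- `τ⁻¹[1]` commutes with the translation. -/
theorem orbitAut_tau (x : Vertex) : orbitAut (tau x) = tau (orbitAut x) := by
  change (diagramAut x.1, x.2 - 1 + 6 + 1) = (diagramAut x.1, x.2 + 6 + 1 - 1)
  congr 1; ring

theorem arrow_diagramAut (i j : Fin 6) :
    Arrow (diagramAut i) (diagramAut j) ↔ Arrow i j := by
  revert i j; decide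

theorem mem_preds (x y : Vertex) :
    y ∈ preds x ↔ (Arrow y.1 x.1 ∧ y.2 = x.2) ∨ (Arrow x.1 y.1 ∧ y.2 = x.2 - 1) := by
  obtain ⟨i, m⟩ := x
  obtain ⟨j, n⟩ := y
  simp [preds, eq_comm]

/-- `τ⁻¹[1]` preserves the arrows, so that it is an automorphism of the translation quiver. -/
theorem orbitAut_mem_preds (x y : Vertex) :
    orbitAut y ∈ preds (orbitAut x) ↔ y ∈ preds x := by
  have h : ∀ z : Vertex, orbitAut z = (diagramAut z.1, z.2 + 6 + 1) := fun _ => rfl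
  simp only [mem_preds, h, arrow_diagramAut]
  constructor <;> rintro (⟨h1, h2⟩ | ⟨h1, h2⟩)
  · exact Or.inl ⟨h1, by omega⟩
  · exact Or.inr ⟨h1, by omega⟩
  · exact Or.inl ⟨h1, by omega⟩
  · exact Or.inr ⟨h1, by omega⟩

/-- Vertices of the Auslander-Reiten quiver of the cluster category of type `E₆`, that is,
isomorphism classes of its indecomposable objects: the orbits of `τ⁻¹[1]` on `ℤE₆`. -/
abbrev ClusterVertex : Type :=
  MulAction.orbitRel.Quotient (Subgroup.zpowers orbitAut) Vertex

/-- The orbit of a vertex of `ℤE₆`. -/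
def toCluster (x : Vertex) : ClusterVertex := Quotient.mk _ x

/-- A function `F` on the vertices of the Auslander-Reiten quiver of the cluster category of type
`E₆` is a (mesh) frieze of type `E₆` if its values are positive integers and every
Auslander-Reiten triangle `A ⟶ ⨁ Bᵢ ⟶ C ⟶` gives `F(A) F(C) = ∏ F(Bᵢ) + 1`. The triangles are the
images of the meshes `τ x ⟶ (predecessors of x) ⟶ x` of `ℤE₆`. -/
def IsFrieze (F : ClusterVertex → ℕ) : Prop :=
  (∀ v, 0 < F v) ∧
    ∀ x : Vertex,
      F (toCluster (tau x)) * F (toCluster x) = (∏ y ∈ preds x, F (toCluster y)) + 1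

end FriezeE6

/-!
The values of a frieze on the vertices `(0, m), …, (5, m)` form a *slice*, and a slice determines the
next one by the mesh relations. As `τ⁻¹[1]` translates by seven steps and reflects the diagram, a
frieze is the same as a sequence of positive slices linked by the mesh relations and satisfying
`q (m + 7) = (q m).mirror` (`isFrieze_iff`, `IsMeshSeq.exists_sliceOf_eq`). It is determined by its
slice at `0`, so the friezes are counted by those slices.

Finiteness comes from `IsMeshSeq.exists_x3_le`: some value in the row of the branch vertex is at most
`25`. Each mesh relation has the form `F(τ x) F(x) = P + 1`, and taking the product of all of them in
one row over a period bounds the Cartan matrix, applied to the logarithms of the geometric means of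
the rows, by the means of `log (1 + 1/P)`. Solving for the row of the branch vertex by the inverse
Cartan matrix has nonnegative coefficients. If all values in this row were large, then `1 + 1/P` would
be close to `1` except in the two outer rows, where it is at most `2`; these two rows contribute
a factor `2 ^ 4`, and the geometric mean of the row would still be less than `26`.

Once the value `c` at the branch vertex is fixed, only finitely many slices are possible: the value
at vertex `1` divides `c + 1`, and three consecutive values `w, x, z` in an outer row satisfy
`x z w = c + w + z`, which bounds them (`mem_arms`). Hence every frieze has a slice in an explicit
finite list, and the iterates of these slices are all the slices of friezes (`mem_allSlices_iff`).
There are `868` of them, by evaluation of the list in the kernel.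
-/

namespace FriezeE6

/-! ### Slices and the mesh relations -/

/-- The six values of a frieze on the vertices `(0, m), …, (5, m)` of `ℤE₆`, for one integer `m`. -/
@[ext]
structure Slice where
  x0 : ℕ
  x1 : ℕ
  x2 : ℕ
  x3 : ℕ
  x4 : ℕ
  x5 : ℕ
deriving DecidableEq

namespace Slice

/-- The values on the vertices `(i, m + 1)` that the mesh relations force from those on the
vertices `(i, m)`. The quotients are rounded down, so the relations hold only if all six divisions
are exact. -/
def next (s : Slice) : Slice :=
  let y0 := (s.x2 + 1) / s.x0
  let y3 := (s.x1 * s.x2 * s.x4 + 1) / s.x3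
  let y5 := (s.x4 + 1) / s.x5
  ⟨y0, (y3 + 1) / s.x1, (y0 * y3 + 1) / s.x2, y3, (y3 * y5 + 1) / s.x4, y5⟩

/-- The action of the diagram automorphism on slices. -/
def mirror (s : Slice) : Slice := ⟨s.x5, s.x1, s.x4, s.x3, s.x2, s.x0⟩

/-- All six values are positive. -/
def Pos (s : Slice) : Prop :=
  0 < s.x0 ∧ 0 < s.x1 ∧ 0 < s.x2 ∧ 0 < s.x3 ∧ 0 < s.x4 ∧ 0 < s.x5

instance (s : Slice) : Decidable s.Pos := by unfold Pos; infer_instance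

/-- The six mesh relations between the values at `m` and those at `m + 1`. The sources `0`, `3`, `5`
of the diagram come before the sinks `1`, `2`, `4` inside a slice. -/
def Mesh (s t : Slice) : Prop :=
  s.x0 * t.x0 = s.x2 + 1 ∧ s.x5 * t.x5 = s.x4 + 1 ∧ s.x3 * t.x3 = s.x1 * s.x2 * s.x4 + 1 ∧
    s.x1 * t.x1 = t.x3 + 1 ∧ s.x2 * t.x2 = t.x0 * t.x3 + 1 ∧ s.x4 * t.x4 = t.x3 * t.x5 + 1

instance (s t : Slice) : Decidable (s.Mesh t) := by unfold Mesh; infer_instance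

/-- The seven steps from a positive slice are exact and end at its mirror image. This is a decidable
condition, and it is equivalent to the slice belonging to a frieze. -/
def Closes (s : Slice) : Prop :=
  s.Pos ∧ (∀ k < 7, (next^[k] s).Mesh (next^[k + 1] s)) ∧ next^[7] s = s.mirror

instance (s : Slice) : Decidable s.Closes := by unfold Closes; infer_instance

end Slice

open Slice

theorem Slice.Mesh.next_eq {s t : Slice} (hs : s.Pos) (h : s.Mesh t) :
    s.next = t := by
  obtain ⟨p0, p1, p2, p3, p4, p5⟩ := hs
  obtain ⟨h0, h5, h3, h1, h2, h4⟩ := h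
  have e0 := Nat.div_eq_of_eq_mul_right p0 h0.symm
  have e5 := Nat.div_eq_of_eq_mul_right p5 h5.symm
  have e3 := Nat.div_eq_of_eq_mul_right p3 h3.symm
  ext
  · exact e0
  · simpa [next, e3] using Nat.div_eq_of_eq_mul_right p1 h1.symm
  · simpa [next, e0, e3] using Nat.div_eq_of_eq_mul_right p2 h2.symm
  · exact e3
  · simpa [next, e3, e5] using Nat.div_eq_of_eq_mul_right p4 h4.symm
  · exact e5

/-! ### Sequences of slices -/

/-- The sequences of slices `(F(0, m), …, F(5, m))` of the friezes `F`: the relation `glide` is the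
invariance under `τ⁻¹[1]`. -/
structure IsMeshSeq (q : ℤ → Slice) : Prop where
  pos : ∀ m, (q m).Pos
  mesh : ∀ m, (q m).Mesh (q (m + 1))
  glide : ∀ m, q (m + 7) = (q m).mirror

namespace IsMeshSeq

variable {q : ℤ → Slice}

theorem shift (h : IsMeshSeq q) (k : ℤ) : IsMeshSeq fun m => q (m + k) where
  pos m := h.pos _
  mesh m := by simpa only [add_right_comm] using h.mesh (m + k)
  glide m := by simpa only [add_right_comm] using h.glide (m + k)

theorem periodic (h : IsMeshSeq q) : Function.Periodic q 14 := fun m => by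
  have := h.glide (m + 7)
  rw [h.glide m, add_assoc] at this
  simpa [mirror] using this

theorem apply_emod (h : IsMeshSeq q) (m : ℤ) : q (m % 14) = q m := by
  rw [← h.periodic.int_mul (m / 14) (m % 14), Int.cast_id]
  congr 1
  omega

theorem iterate_next (h : IsMeshSeq q) (m : ℤ) (k : ℕ) : next^[k] (q m) = q (m + k) := by
  induction k with
  | zero => simp
  | succ k ih =>
    rw [Function.iterate_succ_apply', ih, (h.mesh _).next_eq (h.pos _)]
    push_cast
    rw [add_assoc]

theorem eq_iterate_next (h : IsMeshSeq q) (m : ℤ) : q m = next^[(m % 14).toNat] (q 0) := by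
  rw [h.iterate_next, Int.toNat_of_nonneg (Int.emod_nonneg m (by norm_num)), zero_add,
    h.apply_emod]

theorem closes (h : IsMeshSeq q) (m : ℤ) : (q m).Closes := by
  refine ⟨h.pos m, fun k _ => ?_, ?_⟩
  · rw [h.iterate_next, h.iterate_next]
    simpa [add_assoc] using h.mesh (m + k)
  · rw [h.iterate_next]
    exact h.glide m

end IsMeshSeq

/-! ### A small value in the row of the branch vertex -/

theorem prod_range_succ_eq {n : ℕ} {g : ℕ → ℝ} (h : g n = g 0) :
    ∏ i ∈ Finset.range n, g (i + 1) = ∏ i ∈ Finset.range n, g i := by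
  rcases n with _ | n
  · simp
  · rw [Finset.prod_range_succ, Finset.prod_range_succ', h]

/-- Some value in the row of the branch vertex is at most `25`. Otherwise let `A`, `B`, `C`, `D` be
the products over seven consecutive slices of `x₀ x₅`, `x₂ x₄`, `x₃` and `x₁`. By the glide reflection
they do not change when the window moves by one, so multiplying the mesh relations over the window
gives `A² ≤ 4⁷ B`, `B² ≤ ρ¹⁴ A C²`, `D² ≤ ρ⁷ C` and `C² ≤ σ⁷ D B`, where `ρ = 27/26` and `σ = 676/675`
bound `1 + 1/P` for the products `P` in the meshes of the rows other than `0` and `5`. Eliminating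
`A`, `D` and `B`, which amounts to inverting the Cartan matrix, leaves `C ≤ σ⁴² ρ⁷⁷ 2²⁸ < 26⁷`. -/
theorem IsMeshSeq.exists_x3_le {q : ℤ → Slice} (h : IsMeshSeq q) : ∃ m, (q m).x3 ≤ 25 := by
  by_contra! hlt
  -- rows exchanged by the glide reflection are multiplied together, so that `a`, `b`, `c`, `d` have
  -- period 7
  let a : ℕ → ℝ := fun i => (q i).x0 * (q i).x5
  let b : ℕ → ℝ := fun i => (q i).x2 * (q i).x4
  let c : ℕ → ℝ := fun i => (q i).x3
  let d : ℕ → ℝ := fun i => (q i).x1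
  have h7 : q ((7 : ℕ) : ℤ) = (q ((0 : ℕ) : ℤ)).mirror := h.glide 0
  have ea := prod_range_succ_eq (n := 7) (g := a) (by simp only [a, h7, mirror]; ring)
  have eb := prod_range_succ_eq (n := 7) (g := b) (by simp only [b, h7, mirror]; ring)
  have ec := prod_range_succ_eq (n := 7) (g := c) (by simp only [c, h7, mirror])
  have ed := prod_range_succ_eq (n := 7) (g := d) (by simp only [d, h7, mirror])
  have pa : ∀ i, 0 < a i := fun i => by
    obtain ⟨p0, p1, p2, p3, p4, p5⟩ := h.pos i
    simp only [a]; positivity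
  have pb : ∀ i, 0 < b i := fun i => by
    obtain ⟨p0, p1, p2, p3, p4, p5⟩ := h.pos i
    simp only [b]; positivity
  have pd : ∀ i, 0 < d i := fun i => by
    obtain ⟨p0, p1, p2, p3, p4, p5⟩ := h.pos i
    simp only [d]; positivity
  have pc : ∀ i, 26 ≤ c i := fun i => by
    simp only [c]; exact_mod_cast hlt i
  have pc0 : ∀ i, 0 < c i := fun i => by linarith [pc i]
  have ma : ∀ i, a i * a (i + 1) ≤ 4 * b i := fun i => by
    obtain ⟨h0, h5, h3, h1, h2, h4⟩ := h.mesh i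
    obtain ⟨p0, p1, p2, p3, p4, p5⟩ := h.pos i
    have e0 : ((q i).x0 : ℝ) * (q (i + 1)).x0 = (q i).x2 + 1 := by exact_mod_cast h0
    have e5 : ((q i).x5 : ℝ) * (q (i + 1)).x5 = (q i).x4 + 1 := by exact_mod_cast h5
    have q2 : (1 : ℝ) ≤ (q i).x2 := by exact_mod_cast p2
    have q4 : (1 : ℝ) ≤ (q i).x4 := by exact_mod_cast p4
    calc a i * a (i + 1)
        = ((q i).x0 * (q (i + 1)).x0) * ((q i).x5 * (q (i + 1)).x5) := by
          simp only [a]; push_cast; ring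
      _ = ((q i).x2 + 1) * ((q i).x4 + 1) := by rw [e0, e5]
      _ ≤ (2 * (q i).x2) * (2 * (q i).x4) := by gcongr <;> linarith
      _ = 4 * b i := by simp only [b]; ring
  have mb : ∀ i, b i * b (i + 1) ≤ (27 / 26) ^ 2 * (a (i + 1) * c (i + 1) ^ 2) := fun i => by
    obtain ⟨h0, h5, h3, h1, h2, h4⟩ := h.mesh i
    obtain ⟨p0, p1, p2, p3, p4, p5⟩ := h.pos (i + 1)
    have e2 : ((q i).x2 : ℝ) * (q (i + 1)).x2 = (q (i + 1)).x0 * (q (i + 1)).x3 + 1 := by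
      exact_mod_cast h2
    have e4 : ((q i).x4 : ℝ) * (q (i + 1)).x4 = (q (i + 1)).x3 * (q (i + 1)).x5 + 1 := by
      exact_mod_cast h4
    have q0 : (1 : ℝ) ≤ (q (i + 1)).x0 := by exact_mod_cast p0
    have q5 : (1 : ℝ) ≤ (q (i + 1)).x5 := by exact_mod_cast p5
    have q3 : (26 : ℝ) ≤ (q (i + 1)).x3 := by exact_mod_cast hlt (i + 1)
    calc b i * b (i + 1)
        = ((q i).x2 * (q (i + 1)).x2) * ((q i).x4 * (q (i + 1)).x4) := by
          simp only [b]; push_cast; ring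
      _ = ((q (i + 1)).x0 * (q (i + 1)).x3 + 1) * ((q (i + 1)).x3 * (q (i + 1)).x5 + 1) := by
          rw [e2, e4]
      _ ≤ (27 / 26 * ((q (i + 1)).x0 * (q (i + 1)).x3)) *
            (27 / 26 * ((q (i + 1)).x3 * (q (i + 1)).x5)) := by
          gcongr <;> nlinarith
      _ = _ := by simp only [a, c]; push_cast; ring
  have md : ∀ i, d i * d (i + 1) ≤ 27 / 26 * c (i + 1) := fun i => by
    obtain ⟨h0, h5, h3, h1, h2, h4⟩ := h.mesh i
    have e1 : d i * d (i + 1) = c (i + 1) + 1 := by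
      simp only [c, d]; push_cast; exact_mod_cast h1
    linarith [pc (i + 1)]
  have mc : ∀ i, c i * c (i + 1) ≤ 676 / 675 * (d i * b i) := fun i => by
    obtain ⟨h0, h5, h3, h1, h2, h4⟩ := h.mesh i
    have e3 : c i * c (i + 1) = d i * b i + 1 := by
      simp only [b, c, d]; push_cast; rw [← mul_assoc]; exact_mod_cast h3
    have : (26 : ℝ) * 26 ≤ c i * c (i + 1) :=
      mul_le_mul (pc i) (pc (i + 1)) (by norm_num) (pc0 i).le
    linarith
  have key : ∀ {f g : ℕ → ℝ}, (∀ i, 0 < f i) → (∀ i, f i * f (i + 1) ≤ g i) →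
      ∏ i ∈ Finset.range 7, f (i + 1) = ∏ i ∈ Finset.range 7, f i →
      (∏ i ∈ Finset.range 7, f i) ^ 2 ≤ ∏ i ∈ Finset.range 7, g i := by
    intro f g hf hfg hs
    calc (∏ i ∈ Finset.range 7, f i) ^ 2 = ∏ i ∈ Finset.range 7, f i * f (i + 1) := by
          rw [Finset.prod_mul_distrib, hs, sq]
      _ ≤ _ := Finset.prod_le_prod (fun i _ => (mul_pos (hf i) (hf _)).le) fun i _ => hfg i
  have Ia := key pa ma ea
  have Ib := key pb mb eb
  have Ic := key pc0 mc ec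
  have Id := key pd md ed
  simp only [Finset.prod_mul_distrib, Finset.prod_pow, Finset.prod_const, Finset.card_range,
    ea, ec] at Ia Ib Ic Id
  have pA := Finset.prod_pos fun i (_ : i ∈ Finset.range 7) => pa i
  have pB := Finset.prod_pos fun i (_ : i ∈ Finset.range 7) => pb i
  have pD := Finset.prod_pos fun i (_ : i ∈ Finset.range 7) => pd i
  have pC : (26 : ℝ) ^ 7 ≤ ∏ i ∈ Finset.range 7, c i := by
    simpa using Finset.prod_le_prod (s := Finset.range 7) (f := fun _ => (26 : ℝ)) (g := c)
      (fun _ _ => by norm_num) fun i _ => pc i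
  generalize ∏ i ∈ Finset.range 7, a i = A at *
  generalize ∏ i ∈ Finset.range 7, b i = B at *
  generalize ∏ i ∈ Finset.range 7, c i = C at *
  generalize ∏ i ∈ Finset.range 7, d i = D at *
  have C0 : 0 < C := lt_of_lt_of_le (by norm_num) pC
  -- the first two relations eliminate `A`, the others then eliminate `D` and `B`
  have I1 : B ^ 3 ≤ (27 / 26) ^ 28 * 4 ^ 7 * C ^ 4 := by
    refine le_of_mul_le_mul_right ?_ pB
    calc B ^ 3 * B = (B ^ 2) ^ 2 := by ring
      _ ≤ (((27 / 26) ^ 7) ^ 2 * (A * C ^ 2)) ^ 2 := by gcongr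
      _ = (27 / 26) ^ 28 * A ^ 2 * C ^ 4 := by ring
      _ ≤ (27 / 26) ^ 28 * (4 ^ 7 * B) * C ^ 4 := by gcongr
      _ = _ := by ring
  have I2 : C ≤ (676 / 675) ^ 42 * (27 / 26) ^ 77 * 2 ^ 28 := by
    refine le_of_mul_le_mul_right ?_ (pow_pos C0 11)
    calc C * C ^ 11 = (C ^ 2) ^ 6 := by ring
      _ ≤ ((676 / 675) ^ 7 * (D * B)) ^ 6 := by gcongr
      _ = (676 / 675) ^ 42 * (D ^ 2) ^ 3 * (B ^ 3) ^ 2 := by ring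
      _ ≤ (676 / 675) ^ 42 * ((27 / 26) ^ 7 * C) ^ 3 * ((27 / 26) ^ 28 * 4 ^ 7 * C ^ 4) ^ 2 := by
          gcongr
      _ = _ := by ring
  have := pC.trans I2
  norm_num at this

/-! ### The finite list of slices -/

/-- A linear form used to single out few slices in each frieze. Its coefficients have no meaning
beyond making ties rare. -/
def Slice.rank (s : Slice) : ℕ := s.x0 + 2 * s.x1 + 3 * s.x2 + 5 * s.x3 + 7 * s.x4 + 11 * s.x5

/-- The slice belongs to a frieze, and its rank is minimal among the slices of that frieze whose
central value is at most `25`. The minimality comes first because few slices pass it, which spares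
the kernel most evaluations of `Closes`. -/
def Slice.IsLow (s : Slice) : Prop :=
  (∀ k < 14, (next^[k] s).x3 ≤ 25 → s.rank ≤ (next^[k] s).rank) ∧ s.Closes

instance (s : Slice) : Decidable s.IsLow := by unfold IsLow; infer_instance

/-- The possible values `(x₀, x₂)` on an arm of the diagram in a slice with central value `c`. The
second one is written as `x₀ z - 1`, where `z` is the next value in the row of `x₀`.
The conditions are Boolean tests on numerals, which are cheap for the kernel. -/
def arms (c : ℕ) : List (ℕ × ℕ) :=
  ((List.range (c + 3) ×ˢ List.range (c + 3)).map fun p => (p.1, p.1 * p.2 - 1)).filter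
    fun p => Nat.blt 0 p.2 && ((p.1 * c + 1) % p.2).beq 0

/-- The slices with central value `c` that pass some of the divisibility conditions for belonging to
a frieze: those of the two arms, and those of the vertices `1` and `3`. -/
def candidates (c : ℕ) : List Slice :=
  (((List.range (c + 2)).filter (· ∣ c + 1) ×ˢ (arms c ×ˢ arms c)).map fun p =>
    (⟨p.2.1.1, p.1, p.2.1.2, c, p.2.2.2, p.2.2.1⟩ : Slice)).filter
    fun s => ((s.x1 * s.x2 * s.x4 + 1) % c).beq 0

/-- Representatives of the friezes up to translation, at least one for each class. -/
def lowSlices : List Slice :=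
  ((List.range 26).flatMap candidates).filter fun s => s.IsLow

/-- All slices of the friezes represented in `lowSlices`, possibly with repetitions. -/
def allSlices : List Slice :=
  lowSlices.flatMap fun s => (List.range 14).map fun k => next^[k] s

/-- Here `w` and `z` are the neighbours of `x` in its row, and `p` is the value before `y` in the row
of `y`. The continuant identity `x z w = c + w + z` bounds `x` and `z`. -/
theorem mem_arms {c x y z p : ℕ} (hx : 0 < x) (hy : 0 < y) (h1 : x * z = y + 1)
    (h2 : p * y = x * c + 1) {w : ℕ} (h3 : w * x = p + 1) : (x, y) ∈ arms c := by
  have hp : 0 < p := by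
    rcases Nat.eq_zero_or_pos p with rfl | hp
    · omega
    · exact hp
  have h4 : x * z * w = c + w + z := by
    zify at *
    have hx' : (x : ℤ) ≠ 0 := by omega
    apply mul_left_cancel₀ hx'
    have e1 : (y : ℤ) = x * z - 1 := by linarith
    have e2 : (p : ℤ) = w * x - 1 := by linarith
    rw [e1, e2] at h2
    linear_combination h2
  have hz : 0 < z := Nat.pos_of_mul_pos_left (a := x) (by omega)
  have hw : 0 < w := Nat.pos_of_mul_pos_right (b := x) (by omega)
  have hb : x < c + 3 ∧ z < c + 3 := by
    obtain ⟨x, rfl⟩ := Nat.exists_eq_add_of_le' hx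
    obtain ⟨z, rfl⟩ := Nat.exists_eq_add_of_le' hz
    obtain ⟨w, rfl⟩ := Nat.exists_eq_add_of_le' hw
    rcases Nat.eq_zero_or_pos x with rfl | hx
    · -- for `x = 1` the identity reads `(z - 1) (w - 1) = c + 1`
      have : 1 ≤ w := by omega
      constructor
      · omega
      · nlinarith
    · constructor <;> nlinarith [Nat.zero_le (x * z * w), Nat.zero_le (x * z), Nat.zero_le (x * w),
        Nat.zero_le (z * w)]
  have hd : (x * c + 1) % y = 0 := Nat.mod_eq_zero_of_dvd ⟨p, by rw [← h2, mul_comm]⟩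
  refine List.mem_filter.2 ⟨List.mem_map.2 ⟨(x, z), List.pair_mem_product.2
    ⟨List.mem_range.2 hb.1, List.mem_range.2 hb.2⟩, by simp [h1]⟩, ?_⟩
  simp [hd, Nat.blt_eq, hy]

theorem IsMeshSeq.mem_candidates {q : ℤ → Slice} (h : IsMeshSeq q) (m : ℤ) :
    q m ∈ candidates (q m).x3 := by
  obtain ⟨p0, p1, p2, p3, p4, p5⟩ := h.pos m
  obtain ⟨h0, h5, h3, -, -, -⟩ := h.mesh m
  obtain ⟨g0, g5, -, g1, g2, g4⟩ := h.mesh (m - 1)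
  rw [sub_add_cancel] at g0 g5 g1 g2 g4
  have ha := mem_arms p0 p2 h0 g2 g0
  have hb := mem_arms p5 p4 h5 (by rw [g4, mul_comm]) g5
  have hd : (q m).x1 ∣ (q m).x3 + 1 := ⟨_, by rw [← g1, mul_comm]⟩
  have hd' := Nat.le_of_dvd (Nat.succ_pos _) hd
  have hc : ((q m).x1 * (q m).x2 * (q m).x4 + 1) % (q m).x3 = 0 :=
    Nat.mod_eq_zero_of_dvd ⟨_, h3.symm⟩
  refine List.mem_filter.2 ⟨List.mem_map.2 ⟨((q m).x1, ((q m).x0, (q m).x2),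
    ((q m).x5, (q m).x4)),
    List.pair_mem_product.2 ⟨List.mem_filter.2 ⟨List.mem_range.2 (Nat.lt_succ_of_le hd'),
      by simpa using hd⟩, List.pair_mem_product.2 ⟨ha, hb⟩⟩, rfl⟩, ?_⟩
  rw [hc]
  rfl

/-- Among the slices with central value at most `25`, one of minimal rank lies in `lowSlices`, and
the period 14 leads from it to the slice at `0`. -/
theorem IsMeshSeq.apply_zero_mem {q : ℤ → Slice} (h : IsMeshSeq q) : q 0 ∈ allSlices := by
  obtain ⟨m₀, hm₀⟩ := h.exists_x3_le
  let S := (Finset.range 14).filter fun k : ℕ => (q k).x3 ≤ 25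
  have hS : S.Nonempty := by
    refine ⟨(m₀ % 14).toNat, ?_⟩
    have h0 := Int.emod_nonneg m₀ (by norm_num : (14 : ℤ) ≠ 0)
    have h1 := Int.emod_lt_of_pos m₀ (by norm_num : (0 : ℤ) < 14)
    simp only [S, Finset.mem_filter, Finset.mem_range]
    refine ⟨by omega, ?_⟩
    rwa [Int.toNat_of_nonneg h0, h.apply_emod]
  obtain ⟨k, hk, hmin⟩ := S.exists_min_image (fun k => (q k).rank) hS
  simp only [S, Finset.mem_filter, Finset.mem_range] at hk hmin
  have hlow : (q k).IsLow := by
    refine ⟨fun j _ hj => ?_, h.closes k⟩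
    rw [h.iterate_next] at hj ⊢
    have e : q ((k : ℤ) + j) = q ((k + j) % 14 : ℕ) := by
      rw [← h.apply_emod]
      push_cast
      rfl
    rw [e] at hj ⊢
    exact hmin _ ⟨Nat.mod_lt _ (by norm_num), hj⟩
  refine List.mem_flatMap.2 ⟨q k, List.mem_filter.2 ⟨List.mem_flatMap.2
    ⟨(q k).x3, List.mem_range.2 (by omega), h.mem_candidates k⟩, by simpa using hlow⟩, ?_⟩
  refine List.mem_map.2 ⟨(14 - k) % 14, List.mem_range.2 (Nat.mod_lt _ (by norm_num)), ?_⟩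
  rw [h.iterate_next]
  rcases Nat.eq_zero_or_pos k with rfl | h0
  · rfl
  · rw [Nat.mod_eq_of_lt (by omega), Nat.cast_sub (by omega)]
    simpa using h.periodic 0

/-! ### Slices that extend to a sequence -/

theorem Slice.mirror_next (s : Slice) : s.mirror.next = s.next.mirror := by
  simp only [mirror, next, mul_right_comm s.x1 s.x4 s.x2, mul_comm ((s.x4 + 1) / s.x5),
    mul_comm ((s.x2 + 1) / s.x0)]

theorem Slice.mirror_iterate_next (s : Slice) (k : ℕ) :
    next^[k] s.mirror = (next^[k] s).mirror := by
  induction k with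
  | zero => rfl
  | succ k ih => rw [Function.iterate_succ_apply', ih, mirror_next, Function.iterate_succ_apply']

theorem Slice.Mesh.mirror {s t : Slice} (h : s.Mesh t) : s.mirror.Mesh t.mirror := by
  obtain ⟨h0, h5, h3, h1, h2, h4⟩ := h
  exact ⟨h5, h0, by rw [mul_right_comm]; exact h3, h1, h4.trans (by rw [mul_comm]; rfl),
    h2.trans (by rw [mul_comm]; rfl)⟩

theorem Slice.Mesh.pos {s t : Slice} (h : s.Mesh t) : t.Pos := by
  obtain ⟨h0, h5, h3, h1, h2, h4⟩ := h
  have h : ∀ {a b c : ℕ}, a * b = c + 1 → 0 < b := fun h =>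
    Nat.pos_of_ne_zero fun hb => by simp [hb] at h
  exact ⟨h h0, h h1, h h2, h h3, h h4, h h5⟩

theorem Slice.Closes.iterate_add_seven {s : Slice} (h : s.Closes) (k : ℕ) :
    next^[k + 7] s = (next^[k] s).mirror := by
  rw [Function.iterate_add_apply, h.2.2, mirror_iterate_next]

theorem Slice.Closes.mesh_iterate {s : Slice} (h : s.Closes) (k : ℕ) :
    (next^[k] s).Mesh (next^[k + 1] s) := by
  induction k using Nat.strong_induction_on with
  | _ k ih =>
    rcases lt_or_ge k 7 with hk | hk
    · exact h.2.1 k hk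
    · obtain ⟨k, rfl⟩ := Nat.exists_eq_add_of_le' hk
      rw [h.iterate_add_seven, add_right_comm, h.iterate_add_seven]
      exact (ih k (by omega)).mirror

/-- The converse of `IsMeshSeq.closes`: the sequence of iterates has period 14, so that it extends to
negative indices. -/
theorem Slice.Closes.exists_isMeshSeq {s : Slice} (h : s.Closes) :
    ∃ q, IsMeshSeq q ∧ q 0 = s := by
  have hper : Function.Periodic (fun k => next^[k] s) 14 := fun k => by
    change next^[k + 7 + 7] s = _
    rw [h.iterate_add_seven, h.iterate_add_seven]
    rfl
  have hq : ∀ (m : ℤ) (j : ℕ),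
      next^[((m + j) % 14).toNat] s = next^[(m % 14).toNat + j] s := fun m j => by
    rw [← hper.map_mod_nat ((m % 14).toNat + j)]
    congr 2
    omega
  refine ⟨fun m => next^[(m % 14).toNat] s, ⟨fun m => ?_, fun m => ?_, fun m => ?_⟩, rfl⟩
  · rcases Nat.eq_zero_or_pos (m % 14).toNat with h0 | h0
    · rw [h0]; exact h.1
    · obtain ⟨k, hk⟩ := Nat.exists_eq_add_of_le' h0
      rw [hk]
      exact (h.mesh_iterate k).pos
  · have := h.mesh_iterate (m % 14).toNat
    rwa [← hq m 1] at this
  · have := h.iterate_add_seven (m % 14).toNat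
    rwa [← hq m 7] at this

/-! ### Counting the slices -/

theorem mem_allSlices_iff {s : Slice} : s ∈ allSlices ↔ ∃ q, IsMeshSeq q ∧ q 0 = s := by
  constructor
  · intro hs
    obtain ⟨t, ht, hs⟩ := List.mem_flatMap.1 hs
    obtain ⟨k, -, rfl⟩ := List.mem_map.1 hs
    have ht : t.IsLow := by simpa using (List.mem_filter.1 ht).2
    obtain ⟨q, hq, rfl⟩ := ht.2.exists_isMeshSeq
    exact ⟨_, hq.shift k, by rw [hq.iterate_next]⟩
  · rintro ⟨q, hq, rfl⟩
    exact hq.apply_zero_mem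

/-- The finite computation behind the theorem. The slices are divided into classes by an arbitrary
residue because finding repetitions is quadratic in the length of the list. -/
theorem sum_length_dedup_filter_allSlices : ∑ r ∈ Finset.range 29,
    (allSlices.filter fun s => (s.x2 + s.x4) % 29 = r).dedup.length = 868 := by
  decide +kernel

theorem card_toFinset_allSlices : allSlices.toFinset.card = 868 := by
  rw [← sum_length_dedup_filter_allSlices,
    Finset.card_eq_sum_card_fiberwise (f := fun s => (s.x2 + s.x4) % 29) (t := Finset.range 29)
      fun s _ => Finset.mem_coe.2 (Finset.mem_range.2 (Nat.mod_lt _ (by norm_num)))]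
  refine Finset.sum_congr rfl fun r _ => ?_
  rw [← List.card_toFinset, List.toFinset_filter]
  simp

/-! ### Friezes as sequences of slices -/

/-- The value in row `i` of a slice. -/
def Slice.entry (s : Slice) : Fin 6 → ℕ := ![s.x0, s.x1, s.x2, s.x3, s.x4, s.x5]

/-- The slice of a function on the cluster category at `m`. -/
def sliceOf (F : ClusterVertex → ℕ) (m : ℤ) : Slice :=
  ⟨F (toCluster (0, m)), F (toCluster (1, m)), F (toCluster (2, m)), F (toCluster (3, m)),
    F (toCluster (4, m)), F (toCluster (5, m))⟩

theorem entry_sliceOf (F : ClusterVertex → ℕ) (m : ℤ) (i : Fin 6) :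
    (sliceOf F m).entry i = F (toCluster (i, m)) := by
  fin_cases i <;> rfl

theorem toCluster_orbitAut (x : Vertex) : toCluster (orbitAut x) = toCluster x :=
  Quotient.sound ⟨⟨orbitAut, Subgroup.mem_zpowers _⟩, rfl⟩

theorem preds_zero (m : ℤ) : preds (0, m) = {(2, m - 1)} := by
  have h1 : (Finset.univ.filter fun j => Arrow j 0) = ∅ := by decide
  have h2 : (Finset.univ.filter fun j => Arrow 0 j) = {2} := by decide
  simp only [preds, h1, h2]; rfl

theorem preds_one (m : ℤ) : preds (1, m) = {(3, m)} := by
  have h1 : (Finset.univ.filter fun j => Arrow j 1) = {3} := by decide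
  have h2 : (Finset.univ.filter fun j => Arrow 1 j) = ∅ := by decide
  simp only [preds, h1, h2]; rfl

theorem preds_two (m : ℤ) : preds (2, m) = {(0, m), (3, m)} := by
  have h1 : (Finset.univ.filter fun j => Arrow j 2) = {0, 3} := by decide
  have h2 : (Finset.univ.filter fun j => Arrow 2 j) = ∅ := by decide
  simp [preds, h1, h2]

theorem preds_three (m : ℤ) : preds (3, m) = {(1, m - 1), (2, m - 1), (4, m - 1)} := by
  have h1 : (Finset.univ.filter fun j => Arrow j 3) = ∅ := by decide
  have h2 : (Finset.univ.filter fun j => Arrow 3 j) = {1, 2, 4} := by decide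
  simp [preds, h1, h2]

theorem preds_four (m : ℤ) : preds (4, m) = {(3, m), (5, m)} := by
  have h1 : (Finset.univ.filter fun j => Arrow j 4) = {3, 5} := by decide
  have h2 : (Finset.univ.filter fun j => Arrow 4 j) = ∅ := by decide
  simp [preds, h1, h2]

theorem preds_five (m : ℤ) : preds (5, m) = {(4, m - 1)} := by
  have h1 : (Finset.univ.filter fun j => Arrow j 5) = ∅ := by decide
  have h2 : (Finset.univ.filter fun j => Arrow 5 j) = {4} := by decide
  simp only [preds, h1, h2]; rfl

theorem meshes_iff (F : ClusterVertex → ℕ) (m : ℤ) :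
    (∀ i, F (toCluster (tau (i, m))) * F (toCluster (i, m)) =
      (∏ y ∈ preds (i, m), F (toCluster y)) + 1) ↔
      (sliceOf F (m - 1)).Mesh (sliceOf F m) := by
  have ht : ∀ i, tau (i, m) = (i, m - 1) := fun _ => rfl
  simp [Fin.forall_fin_succ, ht, preds_zero, preds_one, preds_two, preds_three, preds_four,
    preds_five, Mesh, sliceOf, mul_assoc]
  tauto

theorem isFrieze_iff {F : ClusterVertex → ℕ} : IsFrieze F ↔ IsMeshSeq (sliceOf F) := by
  constructor
  · rintro ⟨hp, hm⟩
    refine ⟨fun m => ⟨hp _, hp _, hp _, hp _, hp _, hp _⟩, fun m => ?_, fun m => ?_⟩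
    · have := (meshes_iff F (m + 1)).1 fun i => hm _
      rwa [add_sub_cancel_right] at this
    · have h : ∀ i, F (toCluster (diagramAut i, m + 7)) = F (toCluster (i, m)) := fun i => by
        rw [← toCluster_orbitAut (i, m)]
        congr 2
        change _ = (diagramAut i, m + 6 + 1)
        congr 1; ring
      ext
      exacts [h 5, h 1, h 4, h 3, h 2, h 0]
  · intro h
    constructor
    · rintro ⟨i, m⟩
      obtain ⟨p0, p1, p2, p3, p4, p5⟩ := h.pos m
      change 0 < F (toCluster (i, m))
      fin_cases i <;> assumption
    · rintro ⟨i, m⟩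
      refine (meshes_iff F m).2 ?_ i
      simpa using h.mesh (m - 1)

theorem sliceOf_injective : Function.Injective sliceOf := by
  intro F G h
  funext v
  obtain ⟨⟨i, m⟩, rfl⟩ := Quotient.exists_rep v
  change F (toCluster _) = G (toCluster _)
  rw [← entry_sliceOf F, h, entry_sliceOf]

theorem IsMeshSeq.exists_sliceOf_eq {q : ℤ → Slice} (h : IsMeshSeq q) :
    ∃ F, sliceOf F = q := by
  let f : Vertex → ℕ := fun x => (q x.2).entry x.1
  have hf : ∀ x, f (orbitAut x) = f x := by
    rintro ⟨i, m⟩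
    change (q (m + 6 + 1)).entry (diagramAut i) = (q m).entry i
    rw [add_assoc, show (6 : ℤ) + 1 = 7 by norm_num, h.glide]
    fin_cases i <;> rfl
  have hz : ∀ (g : Subgroup.zpowers orbitAut) (x : Vertex), f (g • x) = f x := by
    rintro ⟨_, k, rfl⟩ x
    change f ((orbitAut ^ k) x) = f x
    induction k using Int.induction_on with
    | zero => rfl
    | succ k ih => rw [add_comm, zpow_add, zpow_one, Equiv.Perm.mul_apply, hf, ih]
    | pred k ih =>
      rw [← hf, ← Equiv.Perm.mul_apply, ← zpow_one_add, add_sub_cancel, ih]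
  refine ⟨Quotient.lift f ?_, ?_⟩
  · rintro _ x ⟨g, rfl⟩
    exact hz g x
  · funext m
    rfl

theorem image_sliceOf_zero :
    (fun F => sliceOf F 0) '' {F | IsFrieze F} = ↑allSlices.toFinset := by
  ext s
  simp only [Set.mem_image, Set.mem_ofPred_eq, Finset.mem_coe, List.mem_toFinset,
    mem_allSlices_iff, isFrieze_iff]
  constructor
  · rintro ⟨F, hF, rfl⟩
    exact ⟨_, hF, rfl⟩
  · rintro ⟨q, hq, rfl⟩
    obtain ⟨F, rfl⟩ := hq.exists_sliceOf_eq
    exact ⟨F, hq, rfl⟩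

theorem injOn_sliceOf_zero : Set.InjOn (fun F => sliceOf F 0) {F | IsFrieze F} := by
  intro F hF G hG h
  refine sliceOf_injective (funext fun m => ?_)
  rw [(isFrieze_iff.1 hF).eq_iterate_next, (isFrieze_iff.1 hG).eq_iterate_next]
  exact congrArg _ h

end FriezeE6

theorem theoremB1 :
    Set.ncard {F : FriezeE6.ClusterVertex → ℕ | FriezeE6.IsFrieze F} = 868 := by
  rw [← FriezeE6.injOn_sliceOf_zero.ncard_image, FriezeE6.image_sliceOf_zero,
    Set.ncard_coe_finset, FriezeE6.card_toFinset_allSlices]
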